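/- Explainable stochastic $d$-halfspace evaluation is the following problem. There are $n$ items; item $i$ is an independent $\{0,1\}$-valued random variable $X_i$ with $\Pr[X_i=1]=p_i\in[0,1]$, and its outcome can be observed by testing it at cost $c_i\ge 0$. We are given $d$ halfspaces, $h_k(x)=1$ if $\sum_{i=1}^n w_{ki}x_i\ge\alpha_k$ and $h_k(x)=0$ otherwise ($k=1,\dots,d$, with $w_{ki},\alpha_k\in\mathbb{R}$ of arbitrary sign), and an arbitrary aggregation function $f:\{0,1\}^d\to\{0,1\}$; write $h(x)=(h_1(x),\dots,h_d(x))$. A tuple $(S,v,T)$ with $S\subseteq\{1,\dots,n\}$, $v\in\{0,1\}^S$ and $T\subseteq\{1,\dots,d\}$ is a witness if (i) for each $k\in T$ the value $h_k(x)$ is the same for all $x\in\{0,1\}^n$ with $x_i=v_i$ for $i\in S$, and (ii) $f(y)$ is the same for all $y\in\{0,1\}^d$ whose coordinates in $T$ equal these values. An adaptive policy tests items one at a time, where the next item (and the decision to stop) may depend on the outcomes observed so far and on internal randomness that is independent of the items; when it stops, it must output $f(h(X))$ and a set $T$ such that $(S,(X_i)_{i\in S},T)$ is a witness, where $S$ is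 the set of items it has tested. A policy is non-adaptive if it is deterministic and tests the items in the order of a fixed list without repetitions, the outcomes being used only to decide when to stop and what to output. The cost of a policy is the total cost of the tests it performs. Theorem. There is an absolute constant $C>0$ such that every instance of this problem has a non-adaptive policy whose expected cost is at most $C\,d^2\log(d+1)$ times the expected cost of every adaptive policy; that is, its expected cost is within a factor $O(d^2\log d)$ (for $d\ge 2$) of that of an optimal adaptive policy. -/

import Mathlib

open scoped ENNReal

/-- An instance of explainable stochastic `d`-halfspace evaluation with `n` items. Item `i` is an
independent Bernoulli variable which is `1` with probability `prob i`; testing it costs `cost i`.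
The `k`-th halfspace is `∑ i, weight k i * X i ≥ threshold k`. -/
structure HalfspaceEvaluation (n d : ℕ) where
  prob : Fin n → ℝ
  prob_nonneg : ∀ i, 0 ≤ prob i
  prob_le_one : ∀ i, prob i ≤ 1
  cost : Fin n → ℝ
  cost_nonneg : ∀ i, 0 ≤ cost i
  weight : Fin d → Fin n → ℝ
  threshold : Fin d → ℝ
  agg : (Fin d → Bool) → Bool

/-- A deterministic adaptive policy, as a decision tree. `output b T` stops, with the claimed value
`b` of the composite function and the set `T` of halfspaces that explains it; `probe i t₀ t₁` tests
item `i` and continues with `t₀` if the outcome is `0` and with `t₁` if it is `1`. -/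
inductive ProbePolicy (n d : ℕ) : Type where
  | output (b : Bool) (T : Finset (Fin d)) : ProbePolicy n d
  | probe (i : Fin n) (t₀ t₁ : ProbePolicy n d) : ProbePolicy n d

namespace ProbePolicy

variable {n d : ℕ}

/-- The items tested under realization `x`, in the order in which they are tested. -/
def path : ProbePolicy n d → (Fin n → Bool) → List (Fin n)
  | output _ _, _ => []
  | probe i t₀ t₁, x => i :: (if x i = true then t₁.path x else t₀.path x)

/-- The function value which is output under realization `x`. -/
def value : ProbePolicy n d → (Fin n → Bool) → Bool
  | output b _, _ => b
  | probe i t₀ t₁, x => if x i = true then t₁.value x else t₀.value x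

/-- The set of halfspaces which is output under realization `x`. -/
def explanation : ProbePolicy n d → (Fin n → Bool) → Finset (Fin d)
  | output _ T, _ => T
  | probe i t₀ t₁, x => if x i = true then t₁.explanation x else t₀.explanation x

/-- The set of items tested under realization `x`. -/
def probed (t : ProbePolicy n d) (x : Fin n → Bool) : Finset (Fin n) :=
  (t.path x).toFinset

/-- A policy is non-adaptive if it tests the items in the order of a fixed list (without
repetitions), the outcomes being used only to decide when to stop and what to output. -/
def IsNonAdaptive (t : ProbePolicy n d) : Prop :=
  ∃ L : List (Fin n), L.Nodup ∧ ∀ x : Fin n → Bool, t.path x <+: L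

end ProbePolicy

namespace HalfspaceEvaluation

variable {n d : ℕ}

/-- `h(x) = (h₁(x), …, h_d(x))`, where `h_k(x)` tells whether the `k`-th halfspace is satisfied. -/
noncomputable def halfspaces (P : HalfspaceEvaluation n d) (x : Fin n → Bool) : Fin d → Bool :=
  fun k => decide (P.threshold k ≤ ∑ i, P.weight k i * (if x i = true then 1 else 0))

/-- The tuple `(S, v, T)` is a witness: the realizations `v` of the items in `S` determine the
halfspaces in `T`, and the values of these determine the aggregation function. -/
structure IsWitness (P : HalfspaceEvaluation n d) (S : Finset (Fin n)) (v : S → Bool)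
    (T : Finset (Fin d)) : Prop where
  determines : ∀ k ∈ T, ∀ x y : Fin n → Bool, (∀ i : S, x i = v i) → (∀ i : S, y i = v i) →
    P.halfspaces x k = P.halfspaces y k
  explains : ∀ x : Fin n → Bool, (∀ i : S, x i = v i) → ∀ z : Fin d → Bool,
    (∀ k ∈ T, z k = P.halfspaces x k) → P.agg z = P.agg (P.halfspaces x)

/-- The policy `t` solves the instance: under every realization it outputs the value of the
composite function, together with a witness formed by the items it tested. -/
def IsSolvedBy (P : HalfspaceEvaluation n d) (t : ProbePolicy n d) : Prop :=
  ∀ x : Fin n → Bool,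
    t.value x = P.agg (P.halfspaces x) ∧
      P.IsWitness (t.probed x) (fun i => x i) (t.explanation x)

/-- The probability of the realization `x`. -/
noncomputable def realizationProb (P : HalfspaceEvaluation n d) (x : Fin n → Bool) : ℝ :=
  ∏ i, if x i = true then P.prob i else 1 - P.prob i

/-- The expected total cost of the tests performed by `t`. -/
noncomputable def expectedCost (P : HalfspaceEvaluation n d) (t : ProbePolicy n d) : ℝ :=
  ∑ x : Fin n → Bool, P.realizationProb x * ((t.path x).map P.cost).sum

/-- The expected cost of a randomized adaptive policy, i.e. of a random decision tree whose law is
`q` and which is independent of the items. -/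
noncomputable def randomizedCost (P : HalfspaceEvaluation n d) (q : PMF (ProbePolicy n d)) : ℝ≥0∞ :=
  ∑' t, q t * ENNReal.ofReal (P.expectedCost t)

end HalfspaceEvaluation

/-! ### Decision trees: tested items and budget truncation -/

namespace ProbePolicy

variable {n d : ℕ}

/-! Whether observed outcomes fix a halfspace at value `b` depends only on a nonnegative sum: the
total |weight| of the tested items whose outcome pushes the halfspace towards `b`. So if a set of
items makes at least as much progress as the items of an adaptive solution, for all `2d` pairs `(k,
b)`, then the same `T` completes it to a witness (`IsWitness.of_progress_le`).

For one pair, budget `B` and set `S` already tested, `exists_dominating` gives a fixed set of cost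
`O(M / δ) * B` whose progress matches that of every policy with budget `B`, except with probability
`δ + exp (1 - M)`, even conditionally on the outcomes in `S`. The set is greedy in expected reward
per cost. Rewards tested by both sides cancel. What the policy collects elsewhere is small by
Markov's inequality, because an item is tested independently of its own outcome. What it leaves in
the set is large by a Chernoff bound, because untested items remain independent of the run.

With `δ = 1 / (16 d)` and `M = 1 + log (16 d)`, a union bound over the `2d` pairs (`exists_phase`)
costs `O(d² log d) * B` and shows that the probability of having no witness is at most a quarter of
its previous value, plus the probability that the solution spends more than `B`. Doubling `B` from
phase to phase and summing gives the theorem. The phases do not depend on the solution, so one list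
serves against all of them. -/

theorem mem_probed_update (t : ProbePolicy n d) (x : Fin n → Bool) (e : Fin n) (b : Bool) :
    e ∈ t.probed (Function.update x e b) ↔ e ∈ t.probed x := by
  induction t with
  | output => simp [probed, path]
  | probe i t₀ t₁ h₀ h₁ =>
    simp only [probed, path, List.mem_toFinset, List.mem_cons] at h₀ h₁ ⊢
    by_cases hi : e = i
    · simp [hi]
    · rw [Function.update_of_ne (Ne.symm hi)]
      split_ifs <;> simp [*]

/-- The policy that stops as soon as the next test would exceed the budget. -/
noncomputable def truncate (c : Fin n → ℝ) : ProbePolicy n d → ℝ → ProbePolicy n d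
  | output b T, _ => output b T
  | probe i t₀ t₁, B =>
    if c i ≤ B then probe i (t₀.truncate c (B - c i)) (t₁.truncate c (B - c i)) else output false ∅

theorem cost_truncate_le (c : Fin n → ℝ) (t : ProbePolicy n d) (x : Fin n → Bool) {B : ℝ}
    (hB : 0 ≤ B) : (((t.truncate c B).path x).map c).sum ≤ B := by
  induction t generalizing B with
  | output => simpa [truncate, path] using hB
  | probe i t₀ t₁ h₀ h₁ =>
    unfold truncate
    split_ifs with h
    · have h₀ := h₀ (sub_nonneg.2 h)
      have h₁ := h₁ (sub_nonneg.2 h)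
      simp only [path, List.map_cons, List.sum_cons]
      split_ifs <;> linarith
    · simpa [path] using hB

theorem path_truncate (c : Fin n → ℝ) (hc : ∀ i, 0 ≤ c i) (t : ProbePolicy n d)
    (x : Fin n → Bool) {B : ℝ} (h : ((t.path x).map c).sum ≤ B) :
    (t.truncate c B).path x = t.path x := by
  induction t generalizing B with
  | output => rfl
  | probe i t₀ t₁ h₀ h₁ =>
    simp only [path, List.map_cons, List.sum_cons] at h
    have hpos : ∀ l : List (Fin n), 0 ≤ (l.map c).sum := fun l =>
      List.sum_nonneg (by simp only [List.mem_map]; rintro _ ⟨i, -, rfl⟩; exact hc i)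
    have hi : c i ≤ B := by linarith [hpos (if x i = true then t₁.path x else t₀.path x)]
    simp only [truncate, hi, if_true, path]
    split_ifs at h ⊢
    · rw [h₁ (by linarith)]
    · rw [h₀ (by linarith)]

theorem sum_probed_le (c : Fin n → ℝ) (hc : ∀ i, 0 ≤ c i) (t : ProbePolicy n d)
    (x : Fin n → Bool) : ∑ i ∈ t.probed x, c i ≤ ((t.path x).map c).sum := by
  unfold probed
  induction t.path x with
  | nil => simp
  | cons i l ih =>
    rw [List.toFinset_cons, List.map_cons, List.sum_cons]
    by_cases h : i ∈ l.toFinset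
    · rw [Finset.insert_eq_of_mem h]; linarith [hc i]
    · rw [Finset.sum_insert h]; linarith

end ProbePolicy

/-! ### Independence along adaptive runs -/

namespace HalfspaceEvaluation

variable {n d : ℕ} (P : HalfspaceEvaluation n d)

/-- The expectation of a function of the realization. -/
noncomputable def expect (G : (Fin n → Bool) → ℝ) : ℝ := ∑ x, P.realizationProb x * G x

theorem realizationProb_nonneg (x : Fin n → Bool) : 0 ≤ P.realizationProb x :=
  Finset.prod_nonneg fun i _ => by
    split_ifs
    · exact P.prob_nonneg i
    · linarith [P.prob_le_one i]

variable {P} in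
theorem expect_mono {F G : (Fin n → Bool) → ℝ} (h : ∀ x, F x ≤ G x) : P.expect F ≤ P.expect G :=
  Finset.sum_le_sum fun x _ => mul_le_mul_of_nonneg_left (h x) (P.realizationProb_nonneg x)

theorem expect_nonneg {F : (Fin n → Bool) → ℝ} (h : ∀ x, 0 ≤ F x) : 0 ≤ P.expect F :=
  Finset.sum_nonneg fun x _ => mul_nonneg (P.realizationProb_nonneg x) (h x)

theorem expect_add (F G : (Fin n → Bool) → ℝ) :
    P.expect (fun x => F x + G x) = P.expect F + P.expect G := by
  simp [expect, mul_add, Finset.sum_add_distrib]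

theorem expect_const_mul (a : ℝ) (F : (Fin n → Bool) → ℝ) :
    P.expect (fun x => a * F x) = a * P.expect F := by
  simp [expect, Finset.mul_sum, mul_left_comm]

theorem expect_sum {ι : Type*} (s : Finset ι) (F : ι → (Fin n → Bool) → ℝ) :
    P.expect (fun x => ∑ j ∈ s, F j x) = ∑ j ∈ s, P.expect (F j) := by
  simp only [expect, Finset.mul_sum]
  exact Finset.sum_comm

/-- The mean of a function of the outcome of item `e`. -/
noncomputable def mean (e : Fin n) (f : Bool → ℝ) : ℝ :=
  P.prob e * f true + (1 - P.prob e) * f false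

theorem mean_nonneg (e : Fin n) {f : Bool → ℝ} (hf : ∀ b, 0 ≤ f b) : 0 ≤ P.mean e f :=
  add_nonneg (mul_nonneg (P.prob_nonneg e) (hf _))
    (mul_nonneg (by linarith [P.prob_le_one e]) (hf _))

/-- Independence of item `e` from a function that ignores it. Flipping the outcome of `e` is an
involution on realizations; averaging over its orbits separates the factor of `e`. -/
theorem expect_mul_apply (e : Fin n) (f : Bool → ℝ) {G : (Fin n → Bool) → ℝ}
    (hG : ∀ x b, G (Function.update x e b) = G x) :
    P.expect (fun x => G x * f (x e)) = P.expect G * P.mean e f := by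
  have hσ : Function.Involutive fun x : Fin n → Bool => Function.update x e (!x e) := by
    intro x; simp
  have key : ∀ H : (Fin n → Bool) → ℝ, 2 * P.expect H = ∑ x, (P.realizationProb x * H x +
      P.realizationProb (Function.update x e (!x e)) * H (Function.update x e (!x e))) := by
    intro H
    rw [Finset.sum_add_distrib, two_mul]
    congr 1
    exact (Equiv.sum_comp hσ.toPerm fun x => P.realizationProb x * H x).symm
  have hw : ∀ x b, P.realizationProb (Function.update x e b) =
      (if b = true then P.prob e else 1 - P.prob e) *
        ∏ i ∈ Finset.univ.erase e, if x i = true then P.prob i else 1 - P.prob i := by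
    intro x b
    rw [realizationProb, ← Finset.mul_prod_erase _ _ (Finset.mem_univ e)]
    simp only [Function.update_self]
    congr 1
    refine Finset.prod_congr rfl fun i hi => ?_
    rw [Function.update_of_ne (Finset.ne_of_mem_erase hi)]
  have h2 : 2 * P.expect (fun x => G x * f (x e)) = 2 * (P.expect G * P.mean e f) := by
    rw [← mul_assoc, key, key, Finset.sum_mul]
    refine Finset.sum_congr rfl fun x _ => ?_
    have hx := hw x (x e)
    rw [Function.update_eq_self] at hx
    rw [hx, hw, hG, Function.update_self, mean]
    cases x e <;> simp <;> ring
  linarith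

/-- Items left untested are still fresh when the policy stops, so each factor contributes its mean.
In the induction the weight `F` absorbs the outcome of the root item, which then leaves `A`; this
also permits repeated tests. -/
theorem expect_mul_prod_unprobed_le (φ : Fin n → Bool → ℝ) (hφ : ∀ e b, 0 ≤ φ e b)
    (t : ProbePolicy n d) (A : Finset (Fin n)) (hA : ∀ e ∈ A, P.mean e (φ e) ≤ 1)
    {F : (Fin n → Bool) → ℝ} (hF : ∀ x, 0 ≤ F x)
    (hFA : ∀ e ∈ A, ∀ x b, F (Function.update x e b) = F x) :
    P.expect (fun x => F x * ∏ e ∈ A \ t.probed x, φ e (x e)) ≤ P.expect F := by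
  induction t generalizing A F with
  | output =>
    simp only [ProbePolicy.probed, ProbePolicy.path, List.toFinset_nil, Finset.sdiff_empty]
    induction A using Finset.induction_on with
    | empty => simp
    | insert a A ha ih =>
      have hne : ∀ e ∈ A, e ≠ a := fun e he h => ha (h ▸ he)
      have h1 : ∀ x b, F (Function.update x a b) *
          ∏ e ∈ A, φ e (Function.update x a b e) = F x * ∏ e ∈ A, φ e (x e) := by
        intro x b
        rw [hFA a (Finset.mem_insert_self _ _)]
        congr 1
        exact Finset.prod_congr rfl fun e he => by rw [Function.update_of_ne (hne e he)]
      have h2 := P.expect_mul_apply a (φ a) (G := fun x => F x * ∏ e ∈ A, φ e (x e)) h1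
      have h3 : ∀ x, F x * ∏ e ∈ insert a A, φ e (x e) =
          (F x * ∏ e ∈ A, φ e (x e)) * φ a (x a) := by
        intro x; rw [Finset.prod_insert ha]; ring
      simp only [h3]
      rw [h2]
      have h4 := ih (fun e he => hA e (Finset.mem_insert_of_mem he))
        (fun e he => hFA e (Finset.mem_insert_of_mem he))
      refine le_trans ?_ h4
      exact mul_le_of_le_one_right (P.expect_nonneg fun x =>
        mul_nonneg (hF x) (Finset.prod_nonneg fun e _ => hφ e _)) (hA a (Finset.mem_insert_self _ _))
  | probe i t₀ t₁ h₀ h₁ =>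
    have side : ∀ (c : Bool) (t : ProbePolicy n d), (∀ (A : Finset (Fin n)),
        (∀ e ∈ A, P.mean e (φ e) ≤ 1) → ∀ {F : (Fin n → Bool) → ℝ}, (∀ x, 0 ≤ F x) →
        (∀ e ∈ A, ∀ x b, F (Function.update x e b) = F x) →
        P.expect (fun x => F x * ∏ e ∈ A \ t.probed x, φ e (x e)) ≤ P.expect F) →
        P.expect (fun x => (if x i = c then F x else 0) *
          ∏ e ∈ A.erase i \ t.probed x, φ e (x e)) ≤
          P.expect (fun x => if x i = c then F x else 0) := by
      intro c t h
      refine h (A.erase i) (fun e he => hA e (Finset.mem_of_mem_erase he)) ?_ ?_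
      · intro x; split_ifs; exacts [hF x, le_rfl]
      · intro e he x b
        rw [Function.update_of_ne (Finset.ne_of_mem_erase he).symm,
          hFA e (Finset.mem_of_mem_erase he)]
    have hA' : ∀ s : Finset (Fin n), A \ insert i s = A.erase i \ s := by
      intro s; ext e; simp only [Finset.mem_sdiff, Finset.mem_insert, Finset.mem_erase]; tauto
    have e1 : ∀ x, F x * ∏ e ∈ A \ (ProbePolicy.probe i t₀ t₁).probed x, φ e (x e) =
        (if x i = true then F x else 0) * ∏ e ∈ A.erase i \ t₁.probed x, φ e (x e) +
        (if x i = false then F x else 0) * ∏ e ∈ A.erase i \ t₀.probed x, φ e (x e) := by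
      intro x
      rw [ProbePolicy.probed, ProbePolicy.path, List.toFinset_cons, hA']
      cases hx : x i <;> simp [ProbePolicy.probed]
    have e2 : ∀ x, F x = (if x i = true then F x else 0) + (if x i = false then F x else 0) := by
      intro x; cases x i <;> simp
    simp only [e1]
    rw [expect_add, show P.expect F = _ from (congrArg P.expect (funext e2)).trans
      (P.expect_add _ _)]
    exact add_le_add (side true t₁ h₁) (side false t₀ h₀)

/-- The decision to test `e` is independent of its outcome, so `Y e` may be replaced by its mean,
which is charged to the cost of `e`; the tested costs add up to at most `B`. -/
theorem expect_mul_sum_probed_le (Y : Fin n → Bool → ℝ) (t : ProbePolicy n d)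
    (U : Finset (Fin n)) {B δ : ℝ} (hB : 0 < B) (hδ : 0 ≤ δ)
    (ht : ∀ x, ((t.path x).map P.cost).sum ≤ B)
    (hY : ∀ e ∈ U, P.cost e ≤ B → P.mean e (Y e) ≤ δ * P.cost e / B)
    {F : (Fin n → Bool) → ℝ} (hF : ∀ x, 0 ≤ F x)
    (hFU : ∀ e ∈ U, ∀ x b, F (Function.update x e b) = F x) :
    P.expect (fun x => F x * ∑ e ∈ U with e ∈ t.probed x, Y e (x e)) ≤ δ * P.expect F := by
  have hsum : ∀ x, ∑ e ∈ t.probed x, P.cost e ≤ B := fun x =>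
    (t.sum_probed_le P.cost P.cost_nonneg x).trans (ht x)
  have h1 : ∀ e ∈ U, P.expect (fun x => (if e ∈ t.probed x then F x else 0) * Y e (x e)) ≤
      P.expect (fun x => (if e ∈ t.probed x then F x else 0) * (δ * P.cost e / B)) := by
    intro e he
    rw [expect_mul_apply]
    · by_cases hc : P.cost e ≤ B
      · simp only [mul_comm _ (δ * P.cost e / B)]
        rw [expect_const_mul, mul_comm]
        refine mul_le_mul_of_nonneg_right (hY e he hc) (P.expect_nonneg fun x => ?_)
        split_ifs; exacts [hF x, le_rfl]
      -- An item dearer than the whole budget is never tested.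
      · have : ∀ x, e ∉ t.probed x := fun x hx => hc
          ((Finset.single_le_sum (fun i _ => P.cost_nonneg i) hx).trans (hsum x))
        simp [this, expect]
    · intro x b
      simp only [t.mem_probed_update, hFU e he]
  calc _ = ∑ e ∈ U, P.expect (fun x => (if e ∈ t.probed x then F x else 0) * Y e (x e)) := by
        rw [← expect_sum]
        congr 1; ext x
        rw [Finset.sum_filter, Finset.mul_sum]
        exact Finset.sum_congr rfl fun e _ => by split_ifs <;> simp
    _ ≤ _ := Finset.sum_le_sum h1
    _ = P.expect (fun x => F x * ((δ / B) * ∑ e ∈ U with e ∈ t.probed x, P.cost e)) := by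
        rw [← expect_sum]
        congr 1; ext x
        rw [Finset.sum_filter, Finset.mul_sum, Finset.mul_sum]
        exact Finset.sum_congr rfl fun e _ => by split_ifs <;> simp; left; ring
    _ ≤ P.expect (fun x => δ * F x) := by
        refine expect_mono fun x => ?_
        rw [mul_comm δ]
        refine mul_le_mul_of_nonneg_left ?_ (hF x)
        have : ∑ e ∈ U with e ∈ t.probed x, P.cost e ≤ B :=
          (Finset.sum_le_sum_of_subset_of_nonneg (fun e he => (Finset.mem_filter.1 he).2)
            fun i _ _ => P.cost_nonneg i).trans (hsum x)
        calc _ ≤ δ / B * B := mul_le_mul_of_nonneg_left this (by positivity)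
          _ = δ := by field_simp
    _ = _ := P.expect_const_mul _ _

end HalfspaceEvaluation

/-! ### Greedy sets that dominate a budgeted policy -/

/-- Discard the item of least key as long as the cost exceeds `T + B`; each discard lowers the cost
by at most `B`, so it never falls below `T`. -/
theorem exists_greedy_subset {ι : Type*} [DecidableEq ι] (key c : ι → ℝ) (E : Finset ι) {B T : ℝ}
    (hcB : ∀ e ∈ E, c e ≤ B) (hT : T ≤ ∑ e ∈ E, c e) (hT0 : 0 < T) :
    ∃ A ⊆ E, T ≤ ∑ e ∈ A, c e ∧ ∑ e ∈ A, c e ≤ T + B ∧ ∀ a ∈ A, ∀ e ∈ E \ A, key e ≤ key a := by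
  induction hk : E.card generalizing E with
  | zero =>
    rw [Finset.card_eq_zero.1 hk, Finset.sum_empty] at hT
    linarith
  | succ k ih =>
    by_cases h : ∑ e ∈ E, c e ≤ T + B
    · exact ⟨E, subset_rfl, hT, h, by simp⟩
    obtain ⟨m, hm, hmin⟩ := E.exists_min_image key (Finset.card_pos.1 (by omega))
    have hsum := Finset.add_sum_erase E c hm
    obtain ⟨A, hAE, h1, h2, h3⟩ := ih (E.erase m)
      (fun e he => hcB e (Finset.mem_of_mem_erase he)) (by linarith [hcB m hm])
      (by rw [Finset.card_erase_of_mem hm, hk]; rfl)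
    refine ⟨A, hAE.trans (Finset.erase_subset _ _), h1, h2, fun a ha e he => ?_⟩
    by_cases hem : e = m
    · exact hem ▸ hmin a (Finset.mem_of_mem_erase (hAE ha))
    · exact h3 a ha e (by simp_all)

namespace HalfspaceEvaluation

variable {n d : ℕ} (P : HalfspaceEvaluation n d)

/-- The one-item lower-tail Chernoff estimate: `exp (-y) ≤ 1 - y / 2` on `[0, 1]`, followed by `1 -
u ≤ exp (-u)`. -/
theorem mean_exp_le_one (e : Fin n) (g : Bool) {y : ℝ} (hy0 : 0 ≤ y) (hy1 : y ≤ 1) :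
    P.mean e (fun b => Real.exp (P.mean e (fun b => if b = g then y else 0) / 2 -
      if b = g then y else 0)) ≤ 1 := by
  have key : ∀ p : ℝ, 0 ≤ p → p * Real.exp (p * y / 2 - y) + (1 - p) * Real.exp (p * y / 2) ≤ 1 := by
    intro p hp
    have h1 : Real.exp (-y) ≤ 1 - y / 2 := by
      rw [Real.exp_neg, inv_le_comm₀ (Real.exp_pos _) (by linarith)]
      have := Real.add_one_le_exp y
      refine le_trans ?_ this
      rw [inv_le_iff_one_le_mul₀ (by linarith)]
      nlinarith
    have h2 := Real.add_one_le_exp (-(p * y / 2))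
    calc _ = Real.exp (p * y / 2) * (p * Real.exp (-y) + (1 - p)) := by
          rw [sub_eq_add_neg, Real.exp_add]; ring
      _ ≤ Real.exp (p * y / 2) * Real.exp (-(p * y / 2)) := by
          refine mul_le_mul_of_nonneg_left ?_ (Real.exp_pos _).le
          nlinarith
      _ = 1 := by rw [← Real.exp_add]; simp
  have h0 := P.prob_nonneg e
  have h1 := P.prob_le_one e
  cases g
  · have := key (1 - P.prob e) (by linarith)
    simp only [mean, Bool.true_eq_false, if_false, if_true, mul_zero, zero_add, sub_zero]
    linarith
  · have := key (P.prob e) h0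
    simp only [mean, Bool.false_eq_true, if_false, if_true, mul_zero, add_zero, sub_zero]
    linarith

/-- A set of items whose total reward dominates what a policy with budget `B` collects outside `S`,
up to a small probability. The reward of `e` is `a e` if its outcome is `g e`, and `0` otherwise. -/
theorem exists_dominating (a : Fin n → ℝ) (g : Fin n → Bool) (ha : ∀ e, 0 ≤ a e)
    (S : Finset (Fin n)) (hS : ∀ e ∉ S, 0 < P.cost e) {B δ M : ℝ} (hB : 0 < B) (hδ : 0 < δ)
    (hM : 0 ≤ M) :
    ∃ A : Finset (Fin n), Disjoint A S ∧ ∑ e ∈ A, P.cost e ≤ (2 * M / δ + 2) * B ∧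
      ∀ t : ProbePolicy n d, (∀ x, ((t.path x).map P.cost).sum ≤ B) →
        ∀ F : (Fin n → Bool) → ℝ, (∀ x, 0 ≤ F x) →
          (∀ e ∉ S, ∀ x b, F (Function.update x e b) = F x) →
          P.expect (fun x => F x * if ∑ e ∈ A, (if x e = g e then a e else 0) <
            ∑ e ∈ t.probed x \ S, (if x e = g e then a e else 0) then 1 else 0) ≤
            (δ + Real.exp (1 - M)) * P.expect F := by
  set π : Fin n → ℝ := fun e => P.mean e fun b => if b = g e then 1 else 0 with hπ
  have hμ : ∀ e y, P.mean e (fun b => if b = g e then y else 0) = π e * y := by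
    intro e y; simp only [hπ, mean]; cases g e <;> simp
  have hπ0 : ∀ e, 0 ≤ π e := fun e => P.mean_nonneg e fun b => by split_ifs <;> norm_num
  have hr0 : ∀ (x : Fin n → Bool) e, 0 ≤ if x e = g e then a e else 0 := fun x e => by
    split_ifs; exacts [ha e, le_rfl]
  -- The discarded affordable items with positive reward are unlikely to be favorable for their
  -- cost: the policy finds even one of them favorable with probability at most `δ`.
  set E : Finset (Fin n) := Finset.univ.filter fun e =>
    e ∉ S ∧ P.cost e ≤ B ∧ 0 < a e ∧ δ * P.cost e / B ≤ π e with hE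
  have hsplit : ∀ (A : Finset (Fin n)) (t : ProbePolicy n d) (x : Fin n → Bool),
      ∑ e ∈ t.probed x \ S, (if x e = g e then a e else 0) ≤
      ∑ e ∈ t.probed x ∩ A, (if x e = g e then a e else 0) +
      ∑ e ∈ Finset.univ \ (S ∪ A) with e ∈ t.probed x, (if x e = g e then a e else 0) := by
    intro A t x
    rw [← Finset.sum_union]
    · refine Finset.sum_le_sum_of_subset_of_nonneg (fun e he => ?_) fun e _ _ => hr0 x e
      simp only [Finset.mem_sdiff, Finset.mem_union, Finset.mem_inter, Finset.mem_filter,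
        Finset.mem_univ, true_and] at he ⊢
      tauto
    · rw [Finset.disjoint_left]
      intro e he
      simp only [Finset.mem_sdiff, Finset.mem_union, Finset.mem_inter, Finset.mem_filter,
        Finset.mem_univ, true_and] at he ⊢
      tauto
  have hinter : ∀ (A : Finset (Fin n)) (t : ProbePolicy n d) (x : Fin n → Bool),
      ∑ e ∈ A, (if x e = g e then a e else 0) =
        ∑ e ∈ t.probed x ∩ A, (if x e = g e then a e else 0) +
        ∑ e ∈ A \ t.probed x, (if x e = g e then a e else 0) := by
    intro A t x
    rw [Finset.inter_comm, Finset.sum_inter_add_sum_sdiff]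
  -- If `E` is cheap, take all of it; otherwise take its densest part.
  rcases lt_or_ge (∑ e ∈ E, P.cost e) ((2 * M / δ + 1) * B) with hlow | hhigh
  · refine ⟨E, ?_, by nlinarith, fun t ht F hF hFS => ?_⟩
    · rw [Finset.disjoint_left]
      intro e he
      exact (Finset.mem_filter.1 he).2.1
    have hout := P.expect_mul_sum_probed_le
      (fun e b => if b = g e then (if 0 < a e then 1 else 0) else 0) t (Finset.univ \ (S ∪ E))
      hB hδ.le ht (fun e he hc => by
        rw [hμ]
        simp only [Finset.mem_sdiff, Finset.mem_univ, true_and, Finset.mem_union, hE,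
          Finset.mem_filter, not_or, not_and, not_le] at he
        have := hS e he.1
        split_ifs with h
        · linarith [he.2 he.1 hc h]
        · rw [mul_zero]; positivity) hF
      (fun e he => hFS e (by simp_all))
    have hF' : 0 ≤ P.expect F := P.expect_nonneg hF
    refine le_trans (expect_mono fun x => mul_le_mul_of_nonneg_left ?_ (hF x)) (hout.trans ?_)
    · split_ifs with hbad
      · have : 0 < ∑ e ∈ Finset.univ \ (S ∪ E) with e ∈ t.probed x,
            (if x e = g e then a e else 0) := by
          have h1 := hsplit E t x
          have h2 := hinter E t x
          have h3 : 0 ≤ ∑ e ∈ E \ t.probed x, (if x e = g e then a e else 0) :=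
            Finset.sum_nonneg fun e _ => hr0 x e
          linarith
        obtain ⟨e, he, hpos⟩ := Finset.exists_ne_zero_of_sum_ne_zero this.ne'
        refine le_trans ?_ (Finset.single_le_sum (fun i _ => ?_) he)
        · have hxe : x e = g e := by by_contra h; exact hpos (if_neg h)
          rw [if_pos hxe] at hpos ⊢
          rw [if_pos ((ha e).lt_of_ne' hpos)]
        · split_ifs <;> norm_num
      · exact Finset.sum_nonneg fun e _ => by split_ifs <;> norm_num
    · nlinarith [Real.exp_pos (1 - M)]
  · have hEpos : ∀ e ∈ E, 0 < a e * π e / P.cost e := by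
      intro e he
      simp only [hE, Finset.mem_filter, Finset.mem_univ, true_and] at he
      have := hS e he.1
      have h1 : 0 < δ * P.cost e / B := by positivity
      have h2 := h1.trans_le he.2.2.2
      have := he.2.2.1
      positivity
    obtain ⟨A, hAE, hTA, hAT, hkey⟩ := exists_greedy_subset (fun e => a e * π e / P.cost e)
      P.cost E (B := B) (fun e he => (Finset.mem_filter.1 he).2.2.1) hhigh (by positivity)
    have hAne : A.Nonempty := by
      rw [Finset.nonempty_iff_ne_empty]
      rintro rfl
      have : 0 < (2 * M / δ + 1) * B := by positivity
      simp only [Finset.sum_empty] at hTA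
      linarith
    obtain ⟨m, hmA, hmin⟩ := A.exists_min_image (fun e => a e * π e / P.cost e) hAne
    have hmpos := hEpos m (hAE hmA)
    -- The scale separating the two sides: at the least density in `A`, spending `B` yields expected
    -- reward `δ * θ`.
    set θ : ℝ := a m * π m / P.cost m * B / δ with hθ
    have hθ0 : 0 < θ := by positivity
    have hAS : ∀ e ∈ A, e ∉ S := fun e he => (Finset.mem_filter.1 (hAE he)).2.1
    refine ⟨A, Finset.disjoint_left.2 hAS, by linarith, fun t ht F hF hFS => ?_⟩
    -- Rewards in units of `θ`, capped at 1 so that the Chernoff estimate applies.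
    set y : Fin n → ℝ := fun e => min (a e / θ) 1 with hy
    have hy0 : ∀ e, 0 ≤ y e := fun e => le_min (div_nonneg (ha e) hθ0.le) zero_le_one
    have hy1 : ∀ e, y e ≤ 1 := fun e => min_le_right _ _
    have hF' : 0 ≤ P.expect F := P.expect_nonneg hF
    have hout := P.expect_mul_sum_probed_le
      (fun e b => if b = g e then y e else 0) t (Finset.univ \ (S ∪ A))
      hB hδ.le ht (fun e he hc => by
        rw [hμ]
        simp only [Finset.mem_sdiff, Finset.mem_univ, true_and, Finset.mem_union, not_or] at he
        have hce := hS e he.1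
        by_cases heE : e ∈ E
        · have h1 := hkey m hmA e (Finset.mem_sdiff.2 ⟨heE, he.2⟩)
          calc π e * y e ≤ π e * (a e / θ) :=
                mul_le_mul_of_nonneg_left (min_le_left _ _) (hπ0 e)
            _ ≤ δ * P.cost e / B := by
                rw [← mul_div_assoc, div_le_div_iff₀ hθ0 hB, hθ]
                rw [div_le_iff₀ hce] at h1
                calc π e * a e * B ≤ (a m * π m / P.cost m * P.cost e) * B :=
                      mul_le_mul_of_nonneg_right (by linarith) hB.le
                  _ = _ := by field_simp
        · simp only [hE, Finset.mem_filter, Finset.mem_univ, true_and, not_and, not_le] at heE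
          rcases (ha e).eq_or_lt with h0 | h0
          · simp only [hy, ← h0, zero_div]
            rw [min_eq_left zero_le_one, mul_zero]; positivity
          · calc π e * y e ≤ π e * 1 := mul_le_mul_of_nonneg_left (hy1 e) (hπ0 e)
              _ ≤ _ := by linarith [heE he.1 hc h0]) hF
      (fun e he => hFS e (by simp_all))
    have hin := P.expect_mul_prod_unprobed_le
      (fun e b => Real.exp (π e * y e / 2 - if b = g e then y e else 0))
      (fun e b => (Real.exp_pos _).le) t A
      (fun e _ => by
        have := P.mean_exp_le_one e (g e) (hy0 e) (hy1 e)
        rwa [hμ] at this) hF (fun e he => hFS e (hAS e he))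
    have hdense : ∀ e ∈ A, δ * P.cost e / B ≤ π e * y e := by
      intro e he
      have heE := Finset.mem_filter.1 (hAE he)
      have hce := hS e heE.2.1
      rw [hy, mul_min_of_nonneg _ _ (hπ0 e), mul_one]
      refine le_min ?_ heE.2.2.2.2
      have h1 := hmin e he
      rw [← mul_div_assoc, div_le_div_iff₀ hB hθ0, hθ]
      rw [le_div_iff₀ hce] at h1
      calc _ = (a m * π m / P.cost m * P.cost e) * B := by field_simp
        _ ≤ π e * a e * B := mul_le_mul_of_nonneg_right (by linarith) hB.le
    have hle_div : ∀ (x : Fin n → Bool) (s : Finset (Fin n)),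
        ∑ e ∈ s, (if x e = g e then y e else 0) ≤
          (∑ e ∈ s, (if x e = g e then a e else 0)) / θ := by
      intro x s
      rw [Finset.sum_div]
      refine Finset.sum_le_sum fun e _ => ?_
      split_ifs
      exacts [min_le_left _ _, by simp]
    -- Capping loses nothing here: either one capped item already gives 1, or no favorable item is
    -- capped.
    have hge_one : ∀ (x : Fin n → Bool) (s : Finset (Fin n)),
        θ ≤ ∑ e ∈ s, (if x e = g e then a e else 0) →
        1 ≤ ∑ e ∈ s, (if x e = g e then y e else 0) := by
      intro x s hs
      by_cases hbig : ∃ e ∈ s, x e = g e ∧ 1 ≤ a e / θ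
      · obtain ⟨e, he, hxe, h1⟩ := hbig
        refine le_trans ?_ (Finset.single_le_sum (fun i _ => ?_) he)
        · simp [hxe, hy, h1]
        · split_ifs; exacts [hy0 i, le_rfl]
      · push Not at hbig
        have : ∑ e ∈ s, (if x e = g e then y e else 0) =
            (∑ e ∈ s, (if x e = g e then a e else 0)) / θ := by
          rw [Finset.sum_div]
          refine Finset.sum_congr rfl fun e he => ?_
          split_ifs with h
          · exact min_eq_left (hbig e he h).le
          · simp
        rw [this, le_div_iff₀ hθ0]
        linarith
    -- After cancelling the common rewards, failure means that the policy gets at least `θ` outside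
    -- `A` (Markov term), or that the untested part of `A` yields at most `θ`. That part costs at
    -- least `2 * M / δ * B`, hence has capped mean at least `2 * M` (Chernoff term).
    have hpt : ∀ x, (if ∑ e ∈ A, (if x e = g e then a e else 0) <
        ∑ e ∈ t.probed x \ S, (if x e = g e then a e else 0) then (1 : ℝ) else 0) ≤
        ∑ e ∈ Finset.univ \ (S ∪ A) with e ∈ t.probed x, (if x e = g e then y e else 0) +
        Real.exp (1 - M) * ∏ e ∈ A \ t.probed x,
          Real.exp (π e * y e / 2 - if x e = g e then y e else 0) := by
      intro x
      have hp1 : 0 ≤ ∑ e ∈ Finset.univ \ (S ∪ A) with e ∈ t.probed x,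
          (if x e = g e then y e else 0) :=
        Finset.sum_nonneg fun e _ => by split_ifs; exacts [hy0 e, le_rfl]
      rw [← Real.exp_sum, ← Real.exp_add]
      have hp2 := Real.exp_pos (1 - M + ∑ e ∈ A \ t.probed x,
        (π e * y e / 2 - if x e = g e then y e else 0))
      split_ifs with hbad
      · by_cases hθout : θ ≤ ∑ e ∈ Finset.univ \ (S ∪ A) with e ∈ t.probed x,
            (if x e = g e then a e else 0)
        · linarith [hge_one x _ hθout]
        · have h1 := hsplit A t x
          have h2 := hinter A t x
          have h3 : ∑ e ∈ A \ t.probed x, (if x e = g e then a e else 0) ≤ θ := by linarith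
          have h4 : ∑ e ∈ A \ t.probed x, (if x e = g e then y e else 0) ≤ 1 :=
            (hle_div x _).trans ((div_le_one hθ0).2 h3)
          have h5 : 2 * M / δ * B ≤ ∑ e ∈ A \ t.probed x, P.cost e := by
            have h6 := Finset.sum_inter_add_sum_sdiff A (t.probed x) P.cost
            have h7 : ∑ e ∈ A ∩ t.probed x, P.cost e ≤ B :=
              (Finset.sum_le_sum_of_subset_of_nonneg Finset.inter_subset_right
                fun i _ _ => P.cost_nonneg i).trans
                ((t.sum_probed_le P.cost P.cost_nonneg x).trans (ht x))
            linarith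
          have h8 : 2 * M ≤ ∑ e ∈ A \ t.probed x, π e * y e := by
            calc 2 * M = δ / B * (2 * M / δ * B) := by field_simp
              _ ≤ δ / B * ∑ e ∈ A \ t.probed x, P.cost e :=
                mul_le_mul_of_nonneg_left h5 (by positivity)
              _ = ∑ e ∈ A \ t.probed x, δ * P.cost e / B := by
                rw [Finset.mul_sum]; exact Finset.sum_congr rfl fun e _ => by ring
              _ ≤ _ := Finset.sum_le_sum fun e he => hdense e (Finset.mem_sdiff.1 he).1
          have h9 : 0 ≤ 1 - M + ∑ e ∈ A \ t.probed x,
              (π e * y e / 2 - if x e = g e then y e else 0) := by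
            rw [Finset.sum_sub_distrib, ← Finset.sum_div]
            linarith
          linarith [Real.one_le_exp h9]
      · linarith
    refine le_trans (expect_mono fun x => mul_le_mul_of_nonneg_left (hpt x) (hF x)) ?_
    simp only [mul_add, mul_left_comm (F _) (Real.exp (1 - M))]
    rw [expect_add, expect_const_mul, add_mul]
    exact add_le_add hout (mul_le_mul_of_nonneg_left hin (Real.exp_pos _).le)

end HalfspaceEvaluation

/-! ### Witnesses and one-sided progress -/

namespace HalfspaceEvaluation

variable {n d : ℕ} (P : HalfspaceEvaluation n d)

/-- The outcome of item `e` that pushes the `k`-th halfspace towards the value `b`. -/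
noncomputable def favorable (k : Fin d) (b : Bool) (e : Fin n) : Bool :=
  b == decide (0 ≤ P.weight k e)

/-- The contribution of the items in `Q` towards certifying that the `k`-th halfspace has
value `b`. -/
noncomputable def progress (k : Fin d) (b : Bool) (Q : Finset (Fin n)) (x : Fin n → Bool) : ℝ :=
  ∑ e ∈ Q, if x e = P.favorable k b e then |P.weight k e| else 0

theorem progress_mono (k : Fin d) (b : Bool) {Q Q' : Finset (Fin n)} (h : Q ⊆ Q')
    (x : Fin n → Bool) : P.progress k b Q x ≤ P.progress k b Q' x :=
  Finset.sum_le_sum_of_subset_of_nonneg h fun e _ _ => by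
    split_ifs; exacts [abs_nonneg _, le_rfl]

theorem progress_congr (k : Fin d) (b : Bool) {Q : Finset (Fin n)} {x y : Fin n → Bool}
    (h : ∀ i ∈ Q, x i = y i) : P.progress k b Q x = P.progress k b Q y :=
  Finset.sum_congr rfl fun e he => by rw [h e he]

theorem score_eq_min_add (k : Fin d) (x : Fin n → Bool) :
    ∑ i, P.weight k i * (if x i = true then 1 else 0) =
      ∑ i, min (P.weight k i) 0 + P.progress k true Finset.univ x := by
  rw [progress, ← Finset.sum_add_distrib]
  refine Finset.sum_congr rfl fun i _ => ?_
  rcases le_or_gt 0 (P.weight k i) with h | h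
  · cases x i <;> simp [favorable, h, abs_of_nonneg]
  · cases x i <;> simp [favorable, h.not_ge, h.le, abs_of_neg h]

theorem score_eq_max_sub (k : Fin d) (x : Fin n → Bool) :
    ∑ i, P.weight k i * (if x i = true then 1 else 0) =
      ∑ i, max (P.weight k i) 0 - P.progress k false Finset.univ x := by
  rw [progress, ← Finset.sum_sub_distrib]
  refine Finset.sum_congr rfl fun i _ => ?_
  rcases le_or_gt 0 (P.weight k i) with h | h
  · cases x i <;> simp [favorable, h, abs_of_nonneg]
  · cases x i <;> simp [favorable, h.not_ge, h.le, abs_of_neg h]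

theorem progress_adversary (k : Fin d) (b : Bool) (Q : Finset (Fin n)) (x : Fin n → Bool) :
    P.progress k b Finset.univ (fun e => if e ∈ Q then x e else !P.favorable k b e) =
      P.progress k b Q x := by
  rw [progress, progress, ← Finset.sum_subset (Finset.subset_univ Q)]
  · exact Finset.sum_congr rfl fun e he => by simp [he]
  · intro e _ he
    simp [he]

/-- Completing `Q` with all unfavorable outcomes adds no progress, yet the value persists; so the
progress on `Q` alone reaches the threshold, and so does any larger progress. -/
theorem halfspaces_eq_of_progress_le {k : Fin d} {Q Q' : Finset (Fin n)} {x y : Fin n → Bool}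
    (hQ : ∀ z : Fin n → Bool, (∀ i ∈ Q, z i = x i) → P.halfspaces z k = P.halfspaces x k)
    (hle : ∀ b, P.progress k b Q x ≤ P.progress k b Q' x) (hy : ∀ i ∈ Q', y i = x i) :
    P.halfspaces y k = P.halfspaces x k := by
  have hadv := fun b => hQ (fun e => if e ∈ Q then x e else !P.favorable k b e)
    fun i hi => by simp [hi]
  have hprog : ∀ b, P.progress k b Q x ≤ P.progress k b Finset.univ y := fun b =>
    ((hle b).trans_eq (P.progress_congr k b hy).symm).trans
      (P.progress_mono k b (Finset.subset_univ _) y)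
  cases hx : P.halfspaces x k
  · have h := hadv false
    rw [hx, halfspaces, decide_eq_false_iff_not, score_eq_max_sub, progress_adversary] at h
    rw [halfspaces, decide_eq_false_iff_not, score_eq_max_sub]
    linarith [hprog false]
  · have h := hadv true
    rw [hx, halfspaces, decide_eq_true_iff, score_eq_min_add, progress_adversary] at h
    rw [halfspaces, decide_eq_true_iff, score_eq_min_add]
    linarith [hprog true]

/-- The outcomes of the items in `Q` under the realization `x` form a witness. -/
def Certified (Q : Finset (Fin n)) (x : Fin n → Bool) : Prop :=
  ∃ T, P.IsWitness Q (fun i => x i) T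

variable {P} in
theorem IsWitness.of_progress_le {Q Q' : Finset (Fin n)} {x : Fin n → Bool} {T : Finset (Fin d)}
    (h : P.IsWitness Q (fun i => x i) T)
    (hle : ∀ k b, P.progress k b Q x ≤ P.progress k b Q' x) :
    P.IsWitness Q' (fun i => x i) T := by
  have hdet : ∀ k ∈ T, ∀ y : Fin n → Bool, (∀ i : Q', y i = x i) →
      P.halfspaces y k = P.halfspaces x k := fun k hk y hy =>
    P.halfspaces_eq_of_progress_le
      (fun z hz => h.determines k hk z x (fun i => hz i i.2) fun _ => rfl) (hle k)
      fun i hi => hy ⟨i, hi⟩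
  have hexp := h.explains x fun _ => rfl
  refine ⟨fun k hk y z hy hz => (hdet k hk y hy).trans (hdet k hk z hz).symm,
    fun y hy z hz => ?_⟩
  rw [hexp z fun k hk => (hz k hk).trans (hdet k hk y hy),
    hexp (P.halfspaces y) fun k hk => hdet k hk y hy]

theorem Certified.mono {Q Q' : Finset (Fin n)} {x : Fin n → Bool} (h : P.Certified Q x)
    (hQ : Q ⊆ Q') : P.Certified Q' x :=
  let ⟨T, hT⟩ := h
  ⟨T, hT.of_progress_le fun k b => P.progress_mono k b hQ x⟩

theorem certified_congr {Q : Finset (Fin n)} {x y : Fin n → Bool} (h : ∀ i ∈ Q, x i = y i) :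
    P.Certified Q x ↔ P.Certified Q y := by
  have : (fun i : Q => x i) = fun i : Q => y i := funext fun i => h i i.2
  simp only [Certified, this]

theorem certified_univ (x : Fin n → Bool) : P.Certified Finset.univ x := by
  have huniq : ∀ y : Fin n → Bool, (∀ i : (Finset.univ : Finset (Fin n)), y i = x i) → y = x :=
    fun y hy => funext fun i => hy ⟨i, Finset.mem_univ i⟩
  refine ⟨Finset.univ, fun k _ y z hy hz => by rw [huniq y hy, huniq z hz], fun y hy z hz => ?_⟩
  rw [show z = P.halfspaces y from funext fun k => hz k (Finset.mem_univ k)]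

variable {P} in
theorem IsWitness.mono {Q Q' : Finset (Fin n)} {x : Fin n → Bool} {T : Finset (Fin d)}
    (h : P.IsWitness Q (fun i => x i) T) (hQ : Q ⊆ Q') : P.IsWitness Q' (fun i => x i) T :=
  h.of_progress_le fun k b => P.progress_mono k b hQ x

/-! ### Testing a fixed list until a witness appears -/

open Classical in
/-- A set of halfspaces that completes the outcomes of the items in `Q` to a witness, if any. -/
noncomputable def certificate (Q : Finset (Fin n)) (x : Fin n → Bool) : Finset (Fin d) :=
  if h : P.Certified Q x then h.choose else ∅

theorem Certified.isWitness {Q : Finset (Fin n)} {x : Fin n → Bool} (h : P.Certified Q x) :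
    P.IsWitness Q (fun i => x i) (P.certificate Q x) := by
  rw [certificate, dif_pos h]
  exact h.choose_spec

open Classical in
/-- The policy that tests the items of a list in order until the outcomes observed, which are those
of `v` on `Q`, form a witness. -/
noncomputable def listPolicy : List (Fin n) → Finset (Fin n) → (Fin n → Bool) → ProbePolicy n d
  | [], Q, v => .output (P.agg (P.halfspaces v)) (P.certificate Q v)
  | i :: L, Q, v =>
    if P.Certified Q v then .output (P.agg (P.halfspaces v)) (P.certificate Q v)
    else .probe i (listPolicy L (insert i Q) (Function.update v i false))
      (listPolicy L (insert i Q) (Function.update v i true))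

theorem listPolicy_of_certified {L : List (Fin n)} {Q : Finset (Fin n)} {v : Fin n → Bool}
    (h : P.Certified Q v) :
    P.listPolicy L Q v = .output (P.agg (P.halfspaces v)) (P.certificate Q v) := by
  cases L with
  | nil => rfl
  | cons i L => rw [listPolicy, if_pos h]

theorem listPolicy_cons_of_not_certified {i : Fin n} {L : List (Fin n)} {Q : Finset (Fin n)}
    {v : Fin n → Bool} (h : ¬P.Certified Q v) :
    P.listPolicy (i :: L) Q v = .probe i (P.listPolicy L (insert i Q) (Function.update v i false))
      (P.listPolicy L (insert i Q) (Function.update v i true)) := by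
  rw [listPolicy, if_neg h]

theorem listPolicy_nil_path (Q : Finset (Fin n)) (v x : Fin n → Bool) :
    (P.listPolicy [] Q v).path x = [] := rfl

theorem listPolicy_path_prefix (L : List (Fin n)) (Q : Finset (Fin n)) (v x : Fin n → Bool) :
    (P.listPolicy L Q v).path x <+: L := by
  induction L generalizing Q v with
  | nil => rw [listPolicy_nil_path]
  | cons i L ih =>
    by_cases h : P.Certified Q v
    · rw [listPolicy_of_certified P h]
      exact List.nil_prefix
    · rw [listPolicy_cons_of_not_certified P h, ProbePolicy.path]
      refine List.prefix_cons_inj i |>.2 ?_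
      split_ifs <;> exact ih _ _

theorem listPolicy_solves {L : List (Fin n)} {Q : Finset (Fin n)} {v x : Fin n → Bool}
    (hvx : ∀ i ∈ Q, v i = x i) (hL : ∀ i, i ∈ L ∨ i ∈ Q) :
    (P.listPolicy L Q v).value x = P.agg (P.halfspaces x) ∧
      P.IsWitness (Q ∪ (P.listPolicy L Q v).probed x) (fun i => x i)
        ((P.listPolicy L Q v).explanation x) := by
  have hcertified : P.Certified Q v →
      (P.listPolicy L Q v).value x = P.agg (P.halfspaces x) ∧
      P.IsWitness (Q ∪ (P.listPolicy L Q v).probed x) (fun i => x i)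
        ((P.listPolicy L Q v).explanation x) := by
    intro h
    rw [listPolicy_of_certified P h]
    have hw := h.isWitness
    have hvx' : (fun i : Q => v i) = fun i : Q => x i := funext fun i => hvx i i.2
    refine ⟨hw.explains x (fun j => (hvx j j.2).symm) (P.halfspaces v) fun k hk =>
      hw.determines k hk v x (fun _ => rfl) fun j => (hvx j j.2).symm, ?_⟩
    rw [hvx'] at hw
    exact hw.mono Finset.subset_union_left
  cases L with
  | nil =>
    obtain rfl : Q = Finset.univ := Finset.eq_univ_of_forall fun i => by simpa using hL i
    exact hcertified (P.certified_univ v)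
  | cons i L =>
    by_cases h : P.Certified Q v
    · exact hcertified h
    · have hstep := listPolicy_solves (L := L) (Q := insert i Q)
        (v := Function.update v i (x i)) (x := x) (by
          intro j hj
          by_cases hji : j = i
          · subst hji; simp
          · rw [Function.update_of_ne hji]
            exact hvx j ((Finset.mem_insert.1 hj).resolve_left hji)) (by
          intro j
          rcases hL j with hj | hj
          · rcases List.mem_cons.1 hj with rfl | hj
            · exact Or.inr (Finset.mem_insert_self _ _)
            · exact Or.inl hj
          · exact Or.inr (Finset.mem_insert_of_mem hj))
      rw [listPolicy_cons_of_not_certified P h]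
      cases hx : x i <;> rw [hx] at hstep <;>
        simp only [ProbePolicy.value, ProbePolicy.explanation, hx, Bool.false_eq_true, if_true,
          if_false] <;>
        refine ⟨hstep.1, hstep.2.mono fun j hj => ?_⟩ <;>
        simp only [ProbePolicy.probed, ProbePolicy.path, hx, Bool.false_eq_true, if_true, if_false,
          List.toFinset_cons, Finset.mem_union, Finset.mem_insert] at hj ⊢ <;>
        tauto
termination_by L.length

theorem not_certified_of_mem_listPolicy_path {L : List (Fin n)} {Q : Finset (Fin n)}
    {v x : Fin n → Bool} (hvx : ∀ i ∈ Q, v i = x i) {e : Fin n}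
    (he : e ∈ (P.listPolicy L Q v).path x) :
    ∃ L₁ L₂, L = L₁ ++ e :: L₂ ∧ ¬P.Certified (Q ∪ L₁.toFinset) x := by
  induction L generalizing Q v with
  | nil => rw [listPolicy_nil_path] at he; simp at he
  | cons i L ih =>
    by_cases h : P.Certified Q v
    · rw [listPolicy_of_certified P h] at he
      simp [ProbePolicy.path] at he
    · rw [listPolicy_cons_of_not_certified P h, ProbePolicy.path, List.mem_cons] at he
      rcases he with rfl | he
      · exact ⟨[], L, rfl, by simpa [← P.certified_congr hvx] using h⟩
      · obtain ⟨L₁, L₂, rfl, hc⟩ := ih (Q := insert i Q) (v := Function.update v i (x i)) (by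
          intro j hj
          by_cases hji : j = i
          · subst hji; simp
          · rw [Function.update_of_ne hji]
            exact hvx j ((Finset.mem_insert.1 hj).resolve_left hji)) (by
          cases hx : x i <;> simpa [hx] using he)
        refine ⟨i :: L₁, L₂, rfl, ?_⟩
        rwa [List.toFinset_cons, Finset.union_insert, ← Finset.insert_union]

/-- A ranking of the items yields a non-adaptive solution which tests an item only if the items of
smaller rank do not form a witness. -/
theorem exists_nonAdaptive_of_rank (r : Fin n → ℕ) :
    ∃ t : ProbePolicy n d, t.IsNonAdaptive ∧ P.IsSolvedBy t ∧
      ∀ x, (t.path x).Nodup ∧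
        ∀ e ∈ t.path x, ¬P.Certified (Finset.univ.filter fun f => r f < r e) x := by
  set L := (List.finRange n).insertionSort fun e f => r e ≤ r f with hLdef
  have hperm : L.Perm (List.finRange n) := List.perm_insertionSort _ _
  have hnodup : L.Nodup := hperm.nodup_iff.2 (List.nodup_finRange n)
  have hmem : ∀ i, i ∈ L := fun i => hperm.mem_iff.2 (List.mem_finRange i)
  have : IsTrans (Fin n) fun e f => r e ≤ r f := ⟨fun _ _ _ h h' => le_trans h h'⟩
  have : Std.Total (α := Fin n) fun e f => r e ≤ r f := ⟨fun a b => le_total _ _⟩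
  have hsorted : L.Pairwise fun e f => r e ≤ r f := List.pairwise_insertionSort _ _
  refine ⟨P.listPolicy L ∅ fun _ => false,
    ⟨L, hnodup, fun x => P.listPolicy_path_prefix _ _ _ _⟩, fun x => ?_, fun x => ⟨?_, ?_⟩⟩
  · have h := P.listPolicy_solves (L := L) (Q := ∅) (v := fun _ => false) (x := x) (by simp)
      fun i => Or.inl (hmem i)
    rwa [Finset.empty_union] at h
  · exact hnodup.sublist (P.listPolicy_path_prefix _ _ _ _).sublist
  · intro e he hcert
    obtain ⟨L₁, L₂, hL, hc⟩ := P.not_certified_of_mem_listPolicy_path (by simp) he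
    refine hc (hcert.mono P fun f hf => ?_)
    have hf' := (Finset.mem_filter.1 hf).2
    have hfL := hmem f
    rw [hL] at hfL hsorted
    rcases List.mem_append.1 hfL with h | h
    · simp [h]
    · rcases List.mem_cons.1 h with rfl | h
      · exact absurd hf' (lt_irrefl _)
      · have := (List.pairwise_cons.1 (List.pairwise_append.1 hsorted).2.1).1 f h
        omega

end HalfspaceEvaluation

/-! ### Doubling budgets -/

theorem sum_doubling_le {b X : ℝ} (hb : 0 ≤ b) (hX : 0 ≤ X) (N : ℕ) :
    ∑ i ∈ Finset.range N, b * 2 ^ i * (if b * 2 ^ i < X then 1 else 0) ≤ 2 * X := by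
  -- The second bound strengthens the induction: when the last term counts, the sum is at most `2 *
  -- (b * 2 ^ N) < 2 * X`.
  suffices h : ∑ i ∈ Finset.range N, b * 2 ^ i * (if b * 2 ^ i < X then 1 else 0) ≤ 2 * X ∧
      ∑ i ∈ Finset.range N, b * 2 ^ i * (if b * 2 ^ i < X then 1 else 0) ≤ b * 2 ^ N from h.1
  induction N with
  | zero => simp [hb, hX]
  | succ N ih =>
    rw [Finset.sum_range_succ, pow_succ]
    have : 0 ≤ b * 2 ^ N := by positivity
    split_ifs <;> constructor <;> linarith [ih.1, ih.2]

namespace HalfspaceEvaluation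

variable {n d : ℕ} (P : HalfspaceEvaluation n d)

open Classical in
/-- The probability that the outcomes of the items in `Q` do not form a witness. -/
noncomputable def uncertifiedProb (Q : Finset (Fin n)) : ℝ :=
  P.expect fun x => if P.Certified Q x then 0 else 1

/-- The set is the union of the dominating sets of all `2d` pairs. It is chosen before `s`, and is
everything once the budget covers all items, so that the phases terminate. -/
theorem exists_phase (hd : 0 < d) (S : Finset (Fin n)) (hS : ∀ e ∉ S, 0 < P.cost e) {B : ℝ}
    (hB : 0 < B) :
    ∃ S', S ⊆ S' ∧
      ∑ e ∈ S' \ S, P.cost e ≤ 2 * d * (32 * d * (1 + Real.log (16 * d)) + 2) * B ∧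
      (∑ e, P.cost e ≤ B → S' = Finset.univ) ∧
      ∀ s, P.IsSolvedBy s → P.uncertifiedProb S' ≤
        P.expect (fun x => if B < ((s.path x).map P.cost).sum then 1 else 0) +
          P.uncertifiedProb S / 4 := by
  classical
  have hd1 : (1 : ℝ) ≤ d := by exact_mod_cast hd
  have hlog : 0 ≤ Real.log (16 * d) := Real.log_nonneg (by linarith)
  by_cases htot : ∑ e, P.cost e ≤ B
  · refine ⟨Finset.univ, Finset.subset_univ _, ?_, fun _ => rfl, fun s _ => ?_⟩
    · refine (Finset.sum_le_sum_of_subset_of_nonneg (Finset.subset_univ _)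
        fun i _ _ => P.cost_nonneg i).trans (htot.trans (le_mul_of_one_le_left hB.le ?_))
      have : 0 ≤ 32 * d * (1 + Real.log (16 * d)) := by positivity
      nlinarith
    · have h0 : P.uncertifiedProb Finset.univ = 0 := by
        simp [uncertifiedProb, P.certified_univ, expect]
      rw [h0]
      have h1 : 0 ≤ P.uncertifiedProb S := P.expect_nonneg fun x => by split_ifs <;> norm_num
      have h2 : 0 ≤ P.expect fun x => if B < ((s.path x).map P.cost).sum then 1 else 0 :=
        P.expect_nonneg fun x => by split_ifs <;> norm_num
      linarith
  have hδ : (0 : ℝ) < 1 / (16 * d) := by positivity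
  choose A hAS hAc hA using fun kb : Fin d × Bool =>
    P.exists_dominating (fun e => |P.weight kb.1 e|) (P.favorable kb.1 kb.2)
      (fun e => abs_nonneg _) S hS hB hδ (M := 1 + Real.log (16 * d)) (by positivity)
  set U := Finset.univ.biUnion A with hU
  have hUS : Disjoint U S := by
    rw [hU, Finset.disjoint_biUnion_left]
    exact fun kb _ => hAS kb
  refine ⟨S ∪ U, Finset.subset_union_left, ?_, fun h => absurd h htot, fun s hs => ?_⟩
  · rw [Finset.union_sdiff_cancel_left hUS.symm]
    calc ∑ e ∈ U, P.cost e ≤ ∑ kb, ∑ e ∈ A kb, P.cost e := by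
          rw [Finset.sum_comm' (t' := U) (s' := fun e => {kb | e ∈ A kb}) (by
            intro kb e
            simp only [hU, Finset.mem_univ, true_and, Finset.mem_filter, Finset.mem_biUnion]
            exact ⟨fun h => ⟨h, kb, h⟩, fun h => h.1⟩)]
          refine Finset.sum_le_sum fun e he => ?_
          obtain ⟨kb, -, hkb⟩ := Finset.mem_biUnion.1 he
          exact Finset.single_le_sum (f := fun _ => P.cost e) (fun _ _ => P.cost_nonneg e)
            (Finset.mem_filter.2 ⟨Finset.mem_univ kb, hkb⟩)
      _ ≤ ∑ _kb : Fin d × Bool, (2 * (1 + Real.log (16 * d)) / (1 / (16 * d)) + 2) * B :=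
          Finset.sum_le_sum fun kb _ => hAc kb
      _ = _ := by
          simp only [Finset.sum_const, Finset.card_univ, Fintype.card_prod, Fintype.card_fin,
            Fintype.card_bool, nsmul_eq_mul]
          push_cast
          field_simp
          ring
  set F : (Fin n → Bool) → ℝ := fun x => if P.Certified S x then 0 else 1 with hF
  have hF0 : ∀ x, 0 ≤ F x := fun x => by simp only [hF]; split_ifs <;> norm_num
  have hFS : ∀ e ∉ S, ∀ x b, F (Function.update x e b) = F x := by
    intro e he x b
    simp only [hF]
    rw [P.certified_congr fun i hi => Function.update_of_ne (ne_of_mem_of_not_mem hi he) _ _]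
  set t := s.truncate P.cost B with ht
  have htB := s.cost_truncate_le P.cost (hB := hB.le)
  have hbad := fun kb => hA kb t htB F hF0 hFS
  -- Each pair fails with conditional probability at most `1 / (8 d)`, so the `2d` pairs together
  -- give `1 / 4`.
  have hexp : (1 : ℝ) / (16 * d) + Real.exp (1 - (1 + Real.log (16 * d))) = 1 / (8 * d) := by
    rw [sub_add_cancel_left, Real.exp_neg, Real.exp_log (by positivity)]
    field_simp
    norm_num
  rw [hexp] at hbad
  have hpt : ∀ x, (if P.Certified (S ∪ U) x then (0 : ℝ) else 1) ≤
      (if B < ((s.path x).map P.cost).sum then 1 else 0) +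
      ∑ kb : Fin d × Bool, F x * if ∑ e ∈ A kb,
        (if x e = P.favorable kb.1 kb.2 e then |P.weight kb.1 e| else 0) <
        ∑ e ∈ t.probed x \ S, (if x e = P.favorable kb.1 kb.2 e then |P.weight kb.1 e| else 0)
          then 1 else 0 := by
    intro x
    have hnn : ∀ kb ∈ (Finset.univ : Finset (Fin d × Bool)), 0 ≤ F x * if ∑ e ∈ A kb,
        (if x e = P.favorable kb.1 kb.2 e then |P.weight kb.1 e| else 0) <
        ∑ e ∈ t.probed x \ S, (if x e = P.favorable kb.1 kb.2 e then |P.weight kb.1 e| else 0)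
          then (1 : ℝ) else 0 := fun kb _ =>
      mul_nonneg (hF0 x) (by split_ifs <;> norm_num)
    have hsum := Finset.sum_nonneg hnn
    by_cases hc : P.Certified (S ∪ U) x
    · rw [if_pos hc]
      refine add_nonneg ?_ hsum
      split_ifs <;> norm_num
    rw [if_neg hc]
    by_cases hcost : B < ((s.path x).map P.cost).sum
    · rw [if_pos hcost]; linarith
    rw [if_neg hcost, zero_add]
    have hFx : F x = 1 := if_neg fun h => hc (h.mono P Finset.subset_union_left)
    by_contra! hlt
    refine hc ⟨s.explanation x, (hs x).2.of_progress_le fun k b => ?_⟩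
    have hprobed : t.probed x = s.probed x := by
      rw [ProbePolicy.probed, ht, s.path_truncate P.cost P.cost_nonneg x (not_lt.1 hcost),
        ProbePolicy.probed]
    have hkb := (Finset.single_le_sum hnn (Finset.mem_univ (k, b))).trans_lt hlt
    rw [hFx, one_mul] at hkb
    have hle := not_lt.1 fun h => absurd hkb (by rw [if_pos h]; exact lt_irrefl _)
    rw [hprobed] at hle
    have hAU : A (k, b) ⊆ U := Finset.subset_biUnion_of_mem A (Finset.mem_univ (k, b))
    calc P.progress k b (s.probed x) x
        = P.progress k b (s.probed x ∩ S) x + P.progress k b (s.probed x \ S) x :=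
          (Finset.sum_inter_add_sum_sdiff _ _ _).symm
      _ ≤ P.progress k b S x + P.progress k b U x :=
          add_le_add (P.progress_mono k b Finset.inter_subset_right x)
            (hle.trans (P.progress_mono k b hAU x))
      _ = P.progress k b (S ∪ U) x := (Finset.sum_union hUS.symm).symm
  refine (expect_mono hpt).trans ?_
  rw [expect_add, expect_sum]
  refine add_le_add le_rfl ((Finset.sum_le_sum fun kb _ => hbad kb).trans_eq ?_)
  simp only [Finset.sum_const, Finset.card_univ, Fintype.card_prod, Fintype.card_fin,
    Fintype.card_bool, nsmul_eq_mul]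
  push_cast
  rw [uncertifiedProb]
  field_simp
  ring

theorem exists_nonAdaptive_le (hd : 0 < d) :
    ∃ t : ProbePolicy n d, t.IsNonAdaptive ∧ P.IsSolvedBy t ∧ ∀ s, P.IsSolvedBy s →
      P.expectedCost t ≤
        10 * (2 * d * (32 * d * (1 + Real.log (16 * d)) + 2)) * P.expectedCost s := by
  classical
  set K : ℝ := 2 * d * (32 * d * (1 + Real.log (16 * d)) + 2) with hK
  have hd1 : (1 : ℝ) ≤ d := by exact_mod_cast hd
  have hK0 : 0 ≤ K := by
    have : 0 ≤ Real.log (16 * d) := Real.log_nonneg (by linarith)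
    positivity
  obtain ⟨b, hb0, hb⟩ : ∃ b : ℝ, 0 < b ∧ ∀ e, 0 < P.cost e → b ≤ P.cost e := by
    rcases (Finset.univ.filter fun e => 0 < P.cost e).eq_empty_or_nonempty with h | h
    · refine ⟨1, one_pos, fun e he => ?_⟩
      exact absurd he (Finset.filter_eq_empty_iff.1 h (Finset.mem_univ e))
    · obtain ⟨m, hm, hmin⟩ := Finset.exists_min_image _ P.cost h
      exact ⟨P.cost m, (Finset.mem_filter.1 hm).2, fun e he => hmin e (by simp [he])⟩
  have hbpos : ∀ i : ℕ, 0 < b * 2 ^ i := fun i => by positivity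
  choose next hsub hcost hfull hnext using
    fun (i : ℕ) (S : {S : Finset (Fin n) // ∀ e ∉ S, 0 < P.cost e}) =>
      P.exists_phase hd S.1 S.2 (hbpos i)
  -- Free items come first: densities need positive costs, and any later test costs at least `b`.
  let stage : ℕ → {S : Finset (Fin n) // ∀ e ∉ S, 0 < P.cost e} := fun i =>
    Nat.rec ⟨Finset.univ.filter fun e => P.cost e = 0, fun e he =>
      (P.cost_nonneg e).lt_of_ne' (by simpa using he)⟩
      (fun i S => ⟨next i S, fun e he => S.2 e fun h => he (hsub i S h)⟩) i
  have hsub' : ∀ i, (stage i).1 ⊆ (stage (i + 1)).1 := fun i => hsub i (stage i)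
  have hmono : Monotone fun i => (stage i).1 := monotone_nat_of_le_succ hsub'
  obtain ⟨N, hN⟩ : ∃ N : ℕ, ∑ e, P.cost e ≤ b * 2 ^ N := by
    obtain ⟨N, hN⟩ := pow_unbounded_of_one_lt ((∑ e, P.cost e) / b) one_lt_two
    exact ⟨N, by rw [div_lt_iff₀ hb0] at hN; linarith⟩
  have hlast : (stage (N + 1)).1 = Finset.univ := hfull N (stage N) hN
  have hex : ∀ e, ∃ i, e ∈ (stage i).1 := fun e => ⟨N + 1, hlast ▸ Finset.mem_univ e⟩
  obtain ⟨t, hna, hsolve, hpath⟩ := P.exists_nonAdaptive_of_rank fun e => Nat.find (hex e)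
  refine ⟨t, hna, hsolve, fun s hs => ?_⟩
  have hcost_nonneg : ∀ x, 0 ≤ ((s.path x).map P.cost).sum := fun x =>
    List.sum_nonneg (by simp only [List.mem_map]; rintro _ ⟨i, -, rfl⟩; exact P.cost_nonneg i)
  have hbound : ∀ x, ((t.path x).map P.cost).sum ≤ ∑ i ∈ Finset.range (N + 1),
      (K * (b * 2 ^ i)) * (if P.Certified (stage i).1 x then 0 else 1) := by
    intro x
    have h1 : ((t.path x).map P.cost).sum = ∑ e ∈ (t.path x).toFinset, P.cost e :=
      (List.sum_toFinset _ (hpath x).1).symm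
    have h2 : ∀ e ∈ (t.path x).toFinset, P.cost e ≤ ∑ i ∈ Finset.range (N + 1),
        if e ∈ (stage (i + 1)).1 \ (stage i).1 then
          P.cost e * (if P.Certified (stage i).1 x then 0 else 1) else 0 := by
      intro e he
      have hnc := (hpath x).2 e (List.mem_toFinset.1 he)
      have hnn : ∀ i ∈ Finset.range (N + 1), 0 ≤ if e ∈ (stage (i + 1)).1 \ (stage i).1 then
          P.cost e * (if P.Certified (stage i).1 x then 0 else 1) else 0 := by
        intro i _
        have := P.cost_nonneg e
        split_ifs <;> simp [this]
      rcases hr : Nat.find (hex e) with _ | i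
      · have h0 : e ∈ (stage 0).1 := hr ▸ Nat.find_spec (hex e)
        rw [show P.cost e = 0 from (Finset.mem_filter.1 h0).2] at hnn ⊢
        exact Finset.sum_nonneg hnn
      · have hin : e ∈ (stage (i + 1)).1 := hr ▸ Nat.find_spec (hex e)
        have hout : e ∉ (stage i).1 := Nat.find_min (hex e) (by omega)
        have hiN : i < N + 1 := by
          have : Nat.find (hex e) ≤ N + 1 := Nat.find_min' (hex e) (hlast ▸ Finset.mem_univ e)
          omega
        refine le_trans (le_of_eq ?_) (Finset.single_le_sum hnn (Finset.mem_range.2 hiN))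
        rw [if_pos (Finset.mem_sdiff.2 ⟨hin, hout⟩), if_neg, mul_one]
        refine fun h => hnc (h.mono P fun f hf => Finset.mem_filter.2 ⟨Finset.mem_univ f, ?_⟩)
        have := Nat.find_min' (hex f) hf
        omega
    rw [h1]
    refine (Finset.sum_le_sum h2).trans ?_
    rw [Finset.sum_comm]
    refine Finset.sum_le_sum fun i _ => ?_
    have hz : (0 : ℝ) ≤ if P.Certified (stage i).1 x then 0 else 1 := by split_ifs <;> norm_num
    refine le_trans ?_ (mul_le_mul_of_nonneg_right (hcost i (stage i)) hz)
    rw [← Finset.sum_filter, ← Finset.sum_mul]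
    refine mul_le_mul_of_nonneg_right ?_ hz
    exact Finset.sum_le_sum_of_subset_of_nonneg (fun e he => (Finset.mem_filter.1 he).2)
      fun e _ _ => P.cost_nonneg e
  set u : ℕ → ℝ := fun i => P.uncertifiedProb (stage i).1 with hu
  set E := P.expectedCost s with hE
  set V := ∑ i ∈ Finset.range (N + 1), b * 2 ^ i * u i with hV
  have hu0 : ∀ i, 0 ≤ u i := fun i => P.expect_nonneg fun x => by split_ifs <;> norm_num
  -- Without a witness among the free items, `s` must pay for some item, hence at least `b`.
  have hstart : b * u 0 ≤ E := by
    simp only [hu, uncertifiedProb]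
    rw [← expect_const_mul]
    refine expect_mono fun x => ?_
    split_ifs with h
    · simpa using hcost_nonneg x
    · obtain ⟨e, he, hpos⟩ : ∃ e ∈ s.probed x, e ∉ (stage 0).1 := by
        by_contra! hcon
        exact h (Certified.mono P ⟨_, (hs x).2⟩ hcon)
      rw [mul_one]
      exact (hb e ((stage 0).2 e hpos)).trans
        ((Finset.single_le_sum (fun i _ => P.cost_nonneg i) he).trans
          (s.sum_probed_le P.cost P.cost_nonneg x))
  have htail : ∑ i ∈ Finset.range N, b * 2 ^ i *
      P.expect (fun x => if b * 2 ^ i < ((s.path x).map P.cost).sum then 1 else 0) ≤ 2 * E := by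
    simp only [← expect_const_mul]
    rw [← expect_sum]
    refine (expect_mono fun x => sum_doubling_le hb0.le (hcost_nonneg x) N).trans_eq ?_
    rw [expect_const_mul]
    rfl
  -- Doubling the budget against the factor `1 / 4` gives `V ≤ 2 * (2 * E) + V / 2 + E`.
  have hVle : V ≤ 10 * E := by
    have hVN : ∑ i ∈ Finset.range N, b * 2 ^ i * u i ≤ V := by
      rw [hV, Finset.sum_range_succ]
      have := mul_nonneg (hbpos N).le (hu0 N)
      linarith
    have hV1 : V = ∑ i ∈ Finset.range N, b * 2 ^ (i + 1) * u (i + 1) + b * u 0 := by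
      rw [hV, Finset.sum_range_succ']
      simp
    have hstep : ∑ i ∈ Finset.range N, b * 2 ^ (i + 1) * u (i + 1) ≤
        2 * ∑ i ∈ Finset.range N, b * 2 ^ i *
          P.expect (fun x => if b * 2 ^ i < ((s.path x).map P.cost).sum then 1 else 0) +
        1 / 2 * ∑ i ∈ Finset.range N, b * 2 ^ i * u i := by
      rw [Finset.mul_sum, Finset.mul_sum, ← Finset.sum_add_distrib]
      refine Finset.sum_le_sum fun i _ => ?_
      have h := mul_le_mul_of_nonneg_left (hnext i (stage i) s hs) (hbpos i).le
      rw [pow_succ]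
      have hui : u (i + 1) = P.uncertifiedProb (next i (stage i)) := rfl
      have hui' : u i = P.uncertifiedProb (stage i).1 := rfl
      rw [← hui, ← hui'] at h
      linarith
    linarith
  calc P.expectedCost t ≤ P.expect fun x => ∑ i ∈ Finset.range (N + 1),
        (K * (b * 2 ^ i)) * (if P.Certified (stage i).1 x then 0 else 1) := expect_mono hbound
    _ = K * V := by
        rw [expect_sum, hV, Finset.mul_sum]
        refine Finset.sum_congr rfl fun i _ => ?_
        simp only [hu, uncertifiedProb]
        rw [expect_const_mul]
        ring
    _ ≤ K * (10 * E) := mul_le_mul_of_nonneg_left hVle hK0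
    _ = _ := by ring

theorem exists_nonAdaptive_of_no_halfspaces (P : HalfspaceEvaluation n 0) :
    ∃ t : ProbePolicy n 0, t.IsNonAdaptive ∧ P.IsSolvedBy t ∧ P.expectedCost t = 0 :=
  ⟨.output (P.agg Fin.elim0) ∅, ⟨[], List.nodup_nil, fun _ => List.nil_prefix⟩, fun _ =>
    ⟨congrArg P.agg (Subsingleton.elim _ _), fun k => k.elim0, fun _ _ _ _ =>
      congrArg P.agg (Subsingleton.elim _ _)⟩, by simp [expectedCost, ProbePolicy.path]⟩

/-! ### Randomized policies and the final constant -/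

theorem ofReal_le_mul_randomizedCost {c K : ℝ} (hK : 0 ≤ K) (q : PMF (ProbePolicy n d))
    (h : ∀ s ∈ q.support, c ≤ K * P.expectedCost s) :
    ENNReal.ofReal c ≤ ENNReal.ofReal K * P.randomizedCost q := by
  rw [randomizedCost, ← ENNReal.tsum_mul_left]
  calc ENNReal.ofReal c = ∑' s, q s * ENNReal.ofReal c := by
        rw [ENNReal.tsum_mul_right, q.tsum_coe, one_mul]
    _ ≤ _ := by
        refine ENNReal.tsum_le_tsum fun s => ?_
        by_cases hs : s ∈ q.support
        · rw [mul_left_comm, ← ENNReal.ofReal_mul hK]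
          gcongr
          exact h s hs
        · rw [PMF.mem_support_iff, not_not] at hs
          simp [hs]

theorem expectedCost_nonneg (s : ProbePolicy n d) : 0 ≤ P.expectedCost s :=
  P.expect_nonneg fun x =>
    List.sum_nonneg (by simp only [List.mem_map]; rintro _ ⟨i, -, rfl⟩; exact P.cost_nonneg i)

end HalfspaceEvaluation

theorem factor_le_sq_mul_log {d : ℝ} (hd : 1 ≤ d) :
    10 * (2 * d * (32 * d * (1 + Real.log (16 * d)) + 2)) ≤ 5000 * d ^ 2 * Real.log (d + 1) := by
  have h2 : Real.log 2 ≤ Real.log (d + 1) := Real.log_le_log two_pos (by linarith)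
  have hd' : Real.log d ≤ Real.log (d + 1) := Real.log_le_log (by linarith) (by linarith)
  have h16 : Real.log (16 * d) = 4 * Real.log 2 + Real.log d := by
    rw [Real.log_mul (by norm_num) (by linarith), show (16 : ℝ) = 2 ^ 4 by norm_num, Real.log_pow]
    norm_num
  have hl := Real.log_two_gt_d9
  -- With `L = log (d + 1) ≥ log 2 > 1 / 2`: `1 ≤ 2 * L` and `log (16 * d) ≤ 5 * L`.
  have h1 : 1 + Real.log (16 * d) ≤ 7 * Real.log (d + 1) := by rw [h16]; linarith
  have h3 : 2 ≤ 4 * d * Real.log (d + 1) := by nlinarith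
  calc _ ≤ 10 * (2 * d * (32 * d * (7 * Real.log (d + 1)) + 4 * d * Real.log (d + 1))) := by
        gcongr
    _ = 4560 * (d ^ 2 * Real.log (d + 1)) := by ring
    _ ≤ 5000 * (d ^ 2 * Real.log (d + 1)) := by
        have := Real.log_nonneg (show 1 ≤ d + 1 by linarith)
        exact mul_le_mul_of_nonneg_right (by norm_num) (by positivity)
    _ = _ := by ring

theorem theorem2 :
    ∃ C : ℝ, 0 < C ∧ ∀ (n d : ℕ) (P : HalfspaceEvaluation n d),
      ∃ t : ProbePolicy n d, t.IsNonAdaptive ∧ P.IsSolvedBy t ∧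
        ∀ q : PMF (ProbePolicy n d), (∀ s ∈ q.support, P.IsSolvedBy s) →
          ENNReal.ofReal (P.expectedCost t) ≤
            ENNReal.ofReal (C * (d : ℝ) ^ 2 * Real.log ((d : ℝ) + 1)) * P.randomizedCost q := by
  refine ⟨5000, by norm_num, fun n d P => ?_⟩
  rcases d.eq_zero_or_pos with rfl | hd
  · obtain ⟨t, hna, hs, h0⟩ := P.exists_nonAdaptive_of_no_halfspaces
    exact ⟨t, hna, hs, fun q _ => by simp [h0]⟩
  · obtain ⟨t, hna, hs, hle⟩ := P.exists_nonAdaptive_le hd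
    have hd1 : (1 : ℝ) ≤ d := by exact_mod_cast hd
    refine ⟨t, hna, hs, fun q hq => P.ofReal_le_mul_randomizedCost ?_ q fun s hsq => ?_⟩
    · have := Real.log_nonneg (show (1 : ℝ) ≤ (d : ℝ) + 1 by linarith)
      positivity
    · exact (hle s (hq s hsq)).trans
        (mul_le_mul_of_nonneg_right (factor_le_sq_mul_log hd1) (P.expectedCost_nonneg s))
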